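/- Let $ABC$ be a non-degenerate triangle in the Euclidean plane with incenter $I$. Let $\omega_a$ be a circle tangent to the lines $AB$ and $AC$ (possibly degenerate: the point $A$), and let $\Omega$ be a circle through $B$ and $C$ that touches $\omega_a$ at a point $A'$. Let $k$ be a line tangent to $\omega_a$, and let $\omega$ be a circle of positive radius, lying on the same side of line $BC$ as $A$, which touches the segment $BC$ at $D$, the circle $\Omega$ at $P$, and the line $k$ at $E$. Assume that one of the following holds. 1. $\omega_a$ has positive radius and lies in the angle vertical to $\angle BAC$ (its center is on the opposite side of $AC$ from $B$ and on the opposite side of $AB$ from $C$), $\omega_a$ is internally tangent to $\Omega$ (inside $\Omega$), and $\omega$ lies on the same side of $k$ as $\omega_a$. 2. $\omega_a$ has positive radius and lies in the angle $BAC$ (its center is on the same side of $AC$ as $B$, on the same side of $AB$ as $C$, and on the same side of $BC$ as $A$), $\omega_a$ is externally tangent to $\Omega$, and $\omega$ lies on the opposite side of $k$ from $\omega_a$. 3. $\omega_a$ is the point $A$ (so $A'=A$, $\Omega$ is the circumcircle of $ABC$, and $k$ is a line through $A$). Assume moreover that, of the two common tangents of $\omega_a$ and $\omega$ allowed by this description,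 $k$ is the one that touches $\omega$ on the side of $BC$; that is, either $A'=P$, or the points $E$ and $D$ lie strictly on the same side of the line $A'P$. Then $D\neq E$, and the line $DE$ passes through the incenter $I$ of triangle $ABC$, whatever the choice of the line $k$. -/

import Mathlib

open EuclideanGeometry Affine

/-- The Euclidean plane. -/
abbrev Plane : Type := EuclideanSpace ℝ (Fin 2)

/-- Two circles touch at `p`: externally, or internally with either one inside the other. -/
def CirclesTouchAt (s t : Sphere Plane) (p : Plane) : Prop :=
  s.IsExtTangentAt t p ∨ s.IsIntTangentAt t p ∨ t.IsIntTangentAt s p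

/-- First configuration: `ωa` lies in the angle vertical to the angle `BAC`, it touches `Ω`
internally at `A'`, and `ω` lies on the same side of `k` as `ωa`. -/
structure VerticalConfig (A B C : Plane) (ωa Ω ω : Sphere Plane) (k : AffineSubspace ℝ Plane)
    (A' : Plane) : Prop where
  radius_pos : 0 < ωa.radius
  opp_AC : line[ℝ, A, C].SOppSide ωa.center B
  opp_AB : line[ℝ, A, B].SOppSide ωa.center C
  touch : ωa.IsIntTangentAt Ω A'
  side_k : k.SSameSide ω.center ωa.center

/-- Second configuration: `ωa` lies in the angle `BAC`, on the same side of `BC` as `A`, it touches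
`Ω` externally at `A'`, and `ω` lies on the opposite side of `k` from `ωa`. -/
structure InnerConfig (A B C : Plane) (ωa Ω ω : Sphere Plane) (k : AffineSubspace ℝ Plane)
    (A' : Plane) : Prop where
  radius_pos : 0 < ωa.radius
  same_AC : line[ℝ, A, C].SSameSide ωa.center B
  same_AB : line[ℝ, A, B].SSameSide ωa.center C
  same_BC : line[ℝ, B, C].SSameSide ωa.center A
  touch : ωa.IsExtTangentAt Ω A'
  side_k : k.SOppSide ω.center ωa.center

/-- Degenerate configuration: `ωa` has radius zero (so, being tangent to the lines `AB` and `AC`, it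
is the point `A`), and `Ω` passes through this point, which is `A'`. -/
structure PointConfig (ωa Ω : Sphere Plane) (A' : Plane) : Prop where
  radius_zero : ωa.radius = 0
  mem_left : A' ∈ ωa
  mem_right : A' ∈ Ω

/-!
Take Cartesian coordinates with origin `D` and first axis `BC`, and let `b`, `c` be the abscissas of
`B`, `C`. Counting the radius `s` of `ωa` as positive, negative or zero in the three configurations
turns every tangency into one equation. The center of `ωa` lies on the bisector of `A`, so that its
coordinates and `s` are affine functions of a single parameter `m`. Eliminating `Ω` leaves a
quadratic equation for the radius `ρ` of `ω`, whose only positive root is `ρ = -m * (b * c)`. For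
this value the equation satisfied by the contact points of `ω` with the common tangents of `ω` and
`ωa` splits into two linear factors, and one of the two lines is `DI`. By Monge's theorem the line
`A'P` passes through a center of similitude of `ω` and `ωa`; this gives its direction and shows that
the contact point on the other line is separated from `D` by `A'P`.
-/

open scoped RealInnerProductSpace

lemma half_angle_formulas {α β x r : ℝ} (hα : α ≠ 0) (hr : 0 < r) (hu : α ^ 2 + β ^ 2 = 1)
    (h : α * x + β * r = r) :
    0 < α * x ∧ α * (x ^ 2 + r ^ 2) = 2 * x * r ∧ β * (x ^ 2 + r ^ 2) = r ^ 2 - x ^ 2 := by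
  have hβ : β < 1 := by nlinarith [sq_pos_of_ne_zero hα]
  have hx : α * x = r * (1 - β) := by linear_combination h
  have hx' : x * (1 + β) = r * α := by
    apply mul_left_cancel₀ hα
    linear_combination (1 + β) * hx - r * hu
  refine ⟨hx ▸ mul_pos hr (sub_pos.2 hβ), ?_, ?_⟩
  · linear_combination x * hx - r * hx'
  · linear_combination r * hx + x * hx'

/-- In a coordinate system with `B = (b, 0)`, `C = (c, 0)` and incenter `(p, r)`, the point `(u, v)`
lies at signed distance `-s` from both lines `AB` and `AC`, hence on the bisector of `A`. The
parameter `m` is affine in `s`; it makes `u`, `v` and `s` polynomial. -/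
structure BisectorParam (b c p r u v s m : ℝ) : Prop where
  inradius_pos : 0 < r
  left_lt : b < p
  lt_right : p < c
  abscissa : u = p - m * r * (b + c - 2 * p)
  ordinate : v = r + m * ((p - b) * (c - p) + r ^ 2)
  radius : s = m * ((p - b) * (c - p) - r ^ 2) - r
  sq_lt : r ^ 2 < (p - b) * (c - p)

lemma bisector_equations {b c p r u v s α β α' β' : ℝ} (hbc : b < c) (hr : 0 < r)
    (hα : 0 < α * (c - b)) (hα' : 0 < α' * (b - c))
    (hu : α ^ 2 + β ^ 2 = 1) (hu' : α' ^ 2 + β' ^ 2 = 1)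
    (hI : α * (p - b) + β * r = r) (hI' : α' * (p - c) + β' * r = r)
    (hQ : α * (u - b) + β * v = -s) (hQ' : α' * (u - c) + β' * v = -s) :
    (b < p ∧ p < c) ∧
      v * ((p - b) * (c - p) - r ^ 2) =
        2 * r * ((p - b) * (c - p)) + s * ((p - b) * (c - p) + r ^ 2) ∧
      (u - p) * ((p - b) * (c - p) - r ^ 2) = -((s + r) * r * (b + c - 2 * p)) := by
  have hα₀ : 0 < α := pos_of_mul_pos_left hα (sub_pos.2 hbc).le
  have hα₀' : α' < 0 := by nlinarith
  obtain ⟨hx, hα_eq, hβ_eq⟩ := half_angle_formulas hα₀.ne' hr hu hI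
  obtain ⟨hy, hα_eq', hβ_eq'⟩ := half_angle_formulas hα₀'.ne hr hu' hI'
  have hbp : b < p := sub_pos.1 (pos_of_mul_pos_right hx hα₀.le)
  have hpc : p < c := sub_neg.1 (neg_of_mul_pos_right hy hα₀'.le)
  have hB : 2 * (p - b) * r * (u - b) + (r ^ 2 - (p - b) ^ 2) * v =
      -s * ((p - b) ^ 2 + r ^ 2) := by
    linear_combination ((p - b) ^ 2 + r ^ 2) * hQ - (u - b) * hα_eq - v * hβ_eq
  have hC : 2 * (p - c) * r * (u - c) + (r ^ 2 - (p - c) ^ 2) * v =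
      -s * ((p - c) ^ 2 + r ^ 2) := by
    linear_combination ((p - c) ^ 2 + r ^ 2) * hQ' - (u - c) * hα_eq' - v * hβ_eq'
  have hv : v * ((p - b) * (c - p) - r ^ 2) =
      2 * r * ((p - b) * (c - p)) + s * ((p - b) * (c - p) + r ^ 2) := by
    apply mul_left_cancel₀ (sub_pos.2 hbc).ne'
    linear_combination (p - c) * hB - (p - b) * hC
  refine ⟨⟨hbp, hpc⟩, hv, ?_⟩
  apply mul_left_cancel₀ (mul_pos (mul_pos two_pos (sub_pos.2 hbp)) hr).ne'
  linear_combination ((p - b) * (c - p) - r ^ 2) * hB - (r ^ 2 - (p - b) ^ 2) * hv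

lemma exists_bisectorParam_of_unit_normals {a₁ a₂ b c p r u v s α β α' β' : ℝ}
    (hbc : b < c) (hr : 0 < r)
    (hα : 0 < α * (c - b)) (hα' : 0 < α' * (b - c))
    (hu : α ^ 2 + β ^ 2 = 1) (hu' : α' ^ 2 + β' ^ 2 = 1)
    (hI : α * (p - b) + β * r = r) (hI' : α' * (p - c) + β' * r = r)
    (hA : α * (a₁ - b) + β * a₂ = 0) (hA' : α' * (a₁ - c) + β' * a₂ = 0) (ha₂ : 0 < a₂)
    (hQ : α * (u - b) + β * v = -s) (hQ' : α' * (u - c) + β' * v = -s) :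
    ∃ m, BisectorParam b c p r u v s m := by
  rw [← neg_zero] at hA hA'
  obtain ⟨-, ha, -⟩ := bisector_equations hbc hr hα hα' hu hu' hI hI' hA hA'
  obtain ⟨⟨hbp, hpc⟩, hv, hu⟩ := bisector_equations hbc hr hα hα' hu hu' hI hI' hQ hQ'
  have hW : 0 < (p - b) * (c - p) - r ^ 2 := by
    have := mul_pos (sub_pos.2 hbp) (sub_pos.2 hpc)
    rw [zero_mul, add_zero] at ha
    exact pos_of_mul_pos_right (ha ▸ by positivity) ha₂.le
  obtain ⟨m, hm⟩ : ∃ m, s + r = m * ((p - b) * (c - p) - r ^ 2) :=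
    ⟨_, (div_mul_cancel₀ _ hW.ne').symm⟩
  refine ⟨m, hr, hbp, hpc, ?_, ?_, by linear_combination hm, sub_pos.1 hW⟩
  · apply mul_right_cancel₀ hW.ne'
    linear_combination hu - r * (b + c - 2 * p) * hm
  · apply mul_right_cancel₀ hW.ne'
    linear_combination hv + ((p - b) * (c - p) + r ^ 2) * hm

lemma touches_inside_of_mem_segment {b c o₁ o₂ R ρ : ℝ} (hb : b ≤ 0) (hc : 0 ≤ c) (hbc : b < c)
    (hρ : 0 < ρ) (hR : 0 < R) (hB : (b - o₁) ^ 2 + o₂ ^ 2 = R ^ 2)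
    (hC : (c - o₁) ^ 2 + o₂ ^ 2 = R ^ 2) {σ : ℝ} (hσ : σ = ρ ∨ σ = -ρ)
    (h : o₁ ^ 2 + (ρ - o₂) ^ 2 = (R - σ) ^ 2) :
    σ = ρ ∧ 2 * o₁ = b + c ∧ 2 * ρ * (R - o₂) = -(b * c) ∧ b * c < 0 := by
  have ho : 2 * o₁ = b + c := by
    apply mul_left_cancel₀ (sub_pos.2 hbc).ne'
    linear_combination hB - hC
  have ho₂ : o₂ ^ 2 < R ^ 2 := by nlinarith [mul_pos (sub_pos.2 hbc) (sub_pos.2 hbc)]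
  obtain ⟨hl, hu⟩ := abs_lt.1 (abs_lt_of_sq_lt_sq ho₂ hR.le)
  rcases hσ with rfl | rfl
  · have hin : 2 * σ * (R - o₂) = -(b * c) := by linear_combination h - hB - b * ho
    exact ⟨rfl, ho, hin, by linarith [mul_pos hρ (sub_pos.2 hu)]⟩
  · have hext : 2 * ρ * (R + o₂) = b * c := by linear_combination hB - h + b * ho
    nlinarith [mul_nonpos_of_nonpos_of_nonneg hb hc]

/-- For points `(x, y)` and `(x', y')` of the circle of radius `ρ` touching the first axis at the
origin: the side of `(x, y)` and of the origin with respect to a line through `(x', y')`. -/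
lemma chord_side_mul {x y x' y' d₁ d₂ κ ρ : ℝ} (hE : x ^ 2 + y ^ 2 = 2 * ρ * y)
    (hP : (1 + κ ^ 2) * y' = 2 * ρ) (hx' : x' = -κ * y') :
    2 * ρ * y * ((d₁ * (y - y') - d₂ * (x - x')) * (d₁ * (0 - y') - d₂ * (0 - x'))) =
      y' ^ 2 * (d₁ + κ * d₂) * ((x + κ * y) * ((d₁ + κ * d₂) * x + (d₂ - κ * d₁) * y)) := by
  rw [hx']
  linear_combination y' * (d₁ + κ * d₂) * y * (d₁ * y - d₂ * x) * hP -
    y' ^ 2 * (d₁ + κ * d₂) ^ 2 * hE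

namespace BisectorParam

variable {b c p r u v s m ρ : ℝ} (h : BisectorParam b c p r u v s m)

include h

lemma ordinate_sub_radius : v - s = 2 * r * (1 + m * r) := by
  rw [h.ordinate, h.radius]; ring

lemma radius_lt_ordinate (hs : s < 0 → 0 ≤ v) : s < v := by
  rcases lt_or_ge s 0 with hs₀ | hs₀
  · exact hs₀.trans_le (hs hs₀)
  · have hr := h.inradius_pos
    have hm : 0 < m := by nlinarith [h.radius, h.sq_lt]
    have : 0 < 2 * r * (1 + m * r) := by positivity
    linarith [h.ordinate_sub_radius]

lemma one_add_mul_pos (hsv : s < v) : 0 < 1 + m * r := by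
  nlinarith [h.ordinate_sub_radius, h.inradius_pos]

/-- Tangency with `Ω` is a quadratic equation for `ρ`, and one of its roots is negative. -/
lemma radius_eq_of_touches {o₁ o₂ R : ℝ} (hsv : s < v) (hρ : 0 < ρ) (hbc : b * c < 0)
    (ho : 2 * o₁ = b + c) (hin : 2 * ρ * (R - o₂) = -(b * c))
    (hB : (b - o₁) ^ 2 + o₂ ^ 2 = R ^ 2) (hQ : (u - o₁) ^ 2 + (v - o₂) ^ 2 = (R - s) ^ 2) :
    ρ = -m * (b * c) := by
  have hr := h.inradius_pos
  have hmr := h.one_add_mul_pos hsv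
  have hR : R * (4 * ρ * (b * c)) = -((b * c) ^ 2 + ρ ^ 2 * (c - b) ^ 2) := by
    linear_combination 4 * ρ ^ 2 * hB + (2 * ρ * (R + o₂) + b * c) * hin -
      ρ ^ 2 * (2 * o₁ - 3 * b + c) * ho
  have hpow : u ^ 2 + v ^ 2 - s ^ 2 - (b + c) * u - 2 * o₂ * v + 2 * R * s + b * c = 0 := by
    linear_combination hQ - hB + (u - b) * ho
  have hquad : (ρ + m * (b * c)) * (ρ * (c - b) ^ 2 * r * (1 + m * r) -
      b * c * ((p - b) * (c - p))) = 0 := by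
    have : b * c * ρ * (u ^ 2 + v ^ 2 - s ^ 2 - (b + c) * u + b * c) -
        ((b * c) ^ 2 - ρ ^ 2 * (c - b) ^ 2) / 2 * (v - s) - (b * c) ^ 2 * s = 0 := by
      linear_combination b * c * ρ * hpow - b * c * v * hin + (v - s) / 2 * hR
    rw [h.abscissa, h.ordinate, h.radius] at this
    linear_combination this
  have hpos : 0 < ρ * (c - b) ^ 2 * r * (1 + m * r) - b * c * ((p - b) * (c - p)) := by
    have hXY := mul_pos (sub_pos.2 h.left_lt) (sub_pos.2 h.lt_right)
    have : 0 ≤ ρ * (c - b) ^ 2 * r * (1 + m * r) := by positivity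
    linarith [mul_neg_of_neg_of_pos hbc hXY]
  linear_combination (mul_eq_zero.1 hquad).resolve_right hpos.ne'

/-- The two common tangents of `ω` and `ωa` touch `ω` on two lines through the origin; one of them
passes through the incenter. -/
lemma contact_point_factorization {x y : ℝ} (hm : ρ = -m * (b * c))
    (hE : x ^ 2 + y ^ 2 = 2 * ρ * y) (hk : x * u + y * (v - ρ) = ρ * (v - s)) :
    (r * x - p * y) * ((1 + m * r) * x - m * (p - b - c) * y) = 0 := by
  have hquad : (x ^ 2 + y ^ 2) * (v - s) = 2 * y * (x * u + y * (v - ρ)) := by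
    linear_combination (v - s) * hE - 2 * y * hk
  rw [hm, h.abscissa, h.ordinate, h.radius] at hquad
  linear_combination hquad / 2

/-- The direction of the line `A'P` is decomposed along the directions `(1, κ)` and `(-κ, 1)`, where
`κ = m * (b + c)`; the second one is that of the line `DP`. -/
lemma chord_direction {x' y' : ℝ} (hm : ρ = -m * (b * c)) (hPx : x' = -(m * (b + c)) * y')
    (hP : (1 + (m * (b + c)) ^ 2) * y' = 2 * ρ) :
    (ρ * (u - x') + s * x') + m * (b + c) * (ρ * (v - y') + s * (y' - ρ)) =
        ρ * ((1 + 2 * m * r) * (p + m * r * (b + c))) ∧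
      (ρ * (v - y') + s * (y' - ρ)) - m * (b + c) * (ρ * (u - x') + s * x') =
        ρ * (m * (b + c - 2 * p) * (p + m * r * (b + c))) := by
  have halong : u + m * (b + c) * (v - s) = (1 + 2 * m * r) * (p + m * r * (b + c)) := by
    rw [h.abscissa, h.ordinate, h.radius]; ring
  have hacross : v + s - 2 * ρ - m * (b + c) * u =
      m * (b + c - 2 * p) * (p + m * r * (b + c)) := by
    rw [h.abscissa, h.ordinate, h.radius, hm]; ring
  rw [hPx]
  exact ⟨by linear_combination ρ * halong, by linear_combination ρ * hacross + (s - ρ) * hP⟩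

/-- The second common tangent of `ω` and `ωa` touches `ω` on the side of `A'P` opposite to the
origin `D`, unless both tangents coincide. The vector `(d₁, d₂)` is the direction of `A'P`. -/
lemma eq_of_chord_side_nonneg {x y x' y' d₁ d₂ : ℝ} (hsv : s < v) (hρ : 0 < ρ) (hm₀ : 0 < m)
    (hm : ρ = -m * (b * c)) (hE : x ^ 2 + y ^ 2 = 2 * ρ * y) (hP : x' ^ 2 + y' ^ 2 = 2 * ρ * y')
    (hPx : x' = -(m * (b + c)) * y') (hy : 0 < y) (hy' : 0 < y')
    (hd₁ : d₁ = ρ * (u - x') + s * x') (hd₂ : d₂ = ρ * (v - y') + s * (y' - ρ))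
    (hside : 0 ≤ (d₁ * (y - y') - d₂ * (x - x')) * (d₁ * (0 - y') - d₂ * (0 - x')))
    (hother : (1 + m * r) * x = m * (p - b - c) * y) : r * x = p * y := by
  have hr := h.inradius_pos
  have hmr := h.one_add_mul_pos hsv
  have hP' : (1 + (m * (b + c)) ^ 2) * y' = 2 * ρ := by
    apply mul_right_cancel₀ hy'.ne'
    rw [hPx] at hP
    linear_combination hP
  obtain ⟨hdκ, hdκ'⟩ := h.chord_direction hm hPx hP'
  rw [← hd₁, ← hd₂] at hdκ hdκ'
  suffices hT : p + m * r * (b + c) = 0 by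
    apply mul_left_cancel₀ hmr.ne'
    linear_combination r * hother - y * hT
  obtain ⟨T, hT⟩ : ∃ T, T = p + m * r * (b + c) := ⟨_, rfl⟩
  rw [← hT] at hdκ hdκ' ⊢
  have hx₁ : (1 + m * r) * (x + m * (b + c) * y) = m * y * T := by
    rw [hT]; linear_combination hother
  have hx₂ : (1 + m * r) * ((1 + 2 * m * r) * x + m * (b + c - 2 * p) * y) = -(m * y * T) := by
    rw [hT]; linear_combination (1 + 2 * m * r) * hother
  have hneg : 0 ≤ -((1 + 2 * m * r) * (y' * ρ * m * (T * (T * y))) ^ 2) := by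
    have := mul_nonneg (sq_nonneg (1 + m * r))
      (mul_nonneg (mul_nonneg (mul_pos two_pos hρ).le hy.le) hside)
    rw [chord_side_mul hE hP' hPx, hdκ, hdκ'] at this
    linear_combination this + y' ^ 2 * ρ ^ 2 * (1 + 2 * m * r) * T ^ 2 *
      ((1 + m * r) * ((1 + 2 * m * r) * x + m * (b + c - 2 * p) * y) * hx₁ + m * y * T * hx₂)
  by_contra hT₀
  have : 0 < (1 + 2 * m * r) * (y' * ρ * m * (T * (T * y))) ^ 2 := by positivity
  linarith

end BisectorParam

lemma contact_point_coords {b c m o₁ o₂ R ρ x y : ℝ} (hρ : 0 < ρ) (hm : ρ = -m * (b * c))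
    (ho : 2 * o₁ = b + c) (hin : 2 * ρ * (R - o₂) = -(b * c)) (hbc : b * c < 0)
    (hP : x ^ 2 + y ^ 2 = 2 * ρ * y) (hx : R * (0 - o₁) = (R - ρ) * (x - o₁))
    (hy : R * (ρ - o₂) = (R - ρ) * (y - o₂)) :
    0 < y ∧ x = -(m * (b + c)) * y := by
  have hm' : 2 * m * (R - o₂) = 1 := by
    apply mul_left_cancel₀ hbc.ne
    rw [hm] at hin
    linear_combination -hin
  have hRy : (R - ρ) * y = ρ * (R - o₂) := by linear_combination -hy
  have hne : (R - ρ) * y ≠ 0 := by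
    intro h0
    nlinarith
  refine ⟨?_, ?_⟩
  · have : y ≠ 0 := right_ne_zero_of_mul hne
    have : 0 < y ^ 2 := by positivity
    nlinarith [sq_nonneg x]
  · apply mul_left_cancel₀ (left_ne_zero_of_mul hne)
    linear_combination -hx + m * (b + c) * hRy - ρ * ho / 2 + ρ * (b + c) / 2 * hm'

lemma contact_point_ordinate_pos {u v s ρ x y : ℝ} (hρ : 0 < ρ) (hsv : s < v)
    (hE : x ^ 2 + y ^ 2 = 2 * ρ * y) (hk : x * u + y * (v - ρ) = ρ * (v - s)) : 0 < y := by
  have hy : 0 ≤ 2 * ρ * y := hE ▸ by positivity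
  refine (nonneg_of_mul_nonneg_right hy (by positivity)).lt_of_ne' ?_
  rintro rfl
  have hx : x = 0 := by simpa using hE
  have := mul_pos hρ (sub_pos.2 hsv)
  simp [← hk, hx] at this

section Metric

variable {V P : Type*} [NormedAddCommGroup V] [InnerProductSpace ℝ V] [MetricSpace P]
  [NormedAddTorsor V P]

/-- A circle with center `O` and signed radius `σ` touches `t` at `p`: internally for `σ > 0`,
externally for `σ < 0`, while for `σ = 0` it is the point `O = p` of `t`. -/
def IsOrientedTangentAt (t : Sphere P) (O : P) (σ : ℝ) (p : P) : Prop :=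
  p ∈ t ∧ t.radius • (O -ᵥ t.center) = (t.radius - σ) • (p -ᵥ t.center)

namespace IsOrientedTangentAt

variable {s t : Sphere P} {O O' p p' : P} {σ σ' : ℝ}

lemma of_isIntTangentAt_left (h : s.IsIntTangentAt t p) :
    IsOrientedTangentAt t s.center s.radius p := by
  obtain ⟨hs, ht, a, ⟨-, ha₁⟩, ha⟩ := h
  have hr : s.radius = (1 - a) * t.radius := by
    rw [← mem_sphere.1 hs, ← mem_sphere'.1 ht, ← ha, dist_comm, dist_lineMap_right,
      Real.norm_of_nonneg (sub_nonneg.2 ha₁)]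
  refine ⟨ht, ?_⟩
  rw [← ha, AffineMap.lineMap_vsub_left, hr]
  module

lemma of_isIntTangentAt_right (h : t.IsIntTangentAt s p) :
    IsOrientedTangentAt t s.center s.radius p := by
  obtain ⟨ht, hs, a, ⟨-, ha₁⟩, ha⟩ := h
  have hr : t.radius = (1 - a) * s.radius := by
    rw [← mem_sphere.1 ht, ← mem_sphere'.1 hs, ← ha, dist_comm, dist_lineMap_right,
      Real.norm_of_nonneg (sub_nonneg.2 ha₁)]
  refine ⟨ht, ?_⟩
  rw [← ha, AffineMap.left_vsub_lineMap, AffineMap.right_vsub_lineMap, hr,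
    ← neg_vsub_eq_vsub_rev p]
  module

lemma of_isExtTangentAt (h : s.IsExtTangentAt t p) :
    IsOrientedTangentAt t s.center (-s.radius) p := by
  obtain ⟨hs, ht, a, ⟨ha₀, ha₁⟩, ha⟩ := h
  have hr : s.radius = a * dist s.center t.center := by
    rw [← mem_sphere.1 hs, ← ha, dist_lineMap_left, Real.norm_of_nonneg ha₀]
  have hr' : t.radius = (1 - a) * dist s.center t.center := by
    rw [← mem_sphere.1 ht, ← ha, dist_lineMap_right, Real.norm_of_nonneg (sub_nonneg.2 ha₁)]
  refine ⟨ht, ?_⟩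
  rw [← ha, AffineMap.lineMap_vsub_right, hr, hr']
  module

lemma of_radius_eq_zero (hs : s.radius = 0) (hps : p ∈ s) (hpt : p ∈ t) :
    IsOrientedTangentAt t s.center 0 p := by
  rw [mem_sphere, hs, dist_eq_zero] at hps
  exact ⟨hpt, by rw [hps, sub_zero]⟩

lemma map (h : IsOrientedTangentAt t O σ p) (f : P →ᴬ[ℝ] ℝ) :
    t.radius * (f O - f t.center) = (t.radius - σ) * (f p - f t.center) := by
  have := congrArg f.contLinear h.2
  simpa only [map_smul, f.contLinear_map_vsub, vsub_eq_sub, smul_eq_mul] using this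

lemma dist_center_sq (h : IsOrientedTangentAt t O σ p) (ht : 0 < t.radius) :
    dist O t.center ^ 2 = (t.radius - σ) ^ 2 := by
  have := congrArg (‖·‖) h.2
  simp only [norm_smul, ← dist_eq_norm_vsub, mem_sphere.1 h.1, Real.norm_eq_abs,
    abs_of_pos ht] at this
  rw [← sq_abs (t.radius - σ), mul_left_cancel₀ ht.ne' (this.trans (mul_comm _ _))]

/-- Monge's theorem: the contact points are collinear with a center of similitude of the two
touching circles. -/
lemma monge (h : IsOrientedTangentAt t O σ p) (h' : IsOrientedTangentAt t O' σ' p')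
    (f : P →ᴬ[ℝ] ℝ) :
    σ' * (t.radius - σ) * (f p - f p') =
      t.radius * (σ' * (f O - f p') + σ * (f p' - f O')) := by
  linear_combination -σ' * h.map f + σ * h'.map f

end IsOrientedTangentAt

lemma mul_nonneg_of_sameRay {a b : ℝ} (h : SameRay ℝ a b) : 0 ≤ a * b := by
  rcases eq_or_ne a 0 with rfl | ha
  · rw [zero_mul]
  · obtain ⟨r, hr, rfl⟩ := h.exists_nonneg_left ha
    rw [smul_eq_mul, mul_left_comm]
    exact mul_nonneg hr (mul_self_nonneg a)

section Side

variable {l : AffineSubspace ℝ P} {X Y : P} {f : P →ᴬ[ℝ] ℝ}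

lemma mul_nonneg_of_wSameSide (h : l.WSameSide X Y) (hf : ∀ p ∈ l, f p = 0) : 0 ≤ f X * f Y := by
  obtain ⟨p, hp, q, hq, hray⟩ := h
  have := mul_nonneg_of_sameRay (hray.map f.linear)
  simpa [hf p hp, hf q hq] using this

lemma mul_nonpos_of_wOppSide (h : l.WOppSide X Y) (hf : ∀ p ∈ l, f p = 0) : f X * f Y ≤ 0 := by
  obtain ⟨p, hp, q, hq, hray⟩ := h
  have := mul_nonneg_of_sameRay (hray.map f.linear)
  simpa [hf p hp, hf q hq] using this

end Side

section Hyperplane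

variable {l : AffineSubspace ℝ P} {p : P} {s : Sphere P}

lemma affineSpan_insert_eq_top [FiniteDimensional ℝ V] [Nonempty l]
    (hl : Module.finrank ℝ l.direction + 1 = Module.finrank ℝ V) (hp : p ∉ l) :
    affineSpan ℝ (insert p (l : Set P)) = ⊤ := by
  have hne : (l : Set P).Nonempty := Set.nonempty_coe_sort.1 ‹_›
  have hlt : l < affineSpan ℝ (insert p (l : Set P)) := by
    refine lt_of_le_of_ne ((subset_affineSpan ℝ _).trans' (Set.subset_insert _ _)) fun h => hp ?_
    rw [h]
    exact mem_affineSpan ℝ (Set.mem_insert _ _)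
  rw [← AffineSubspace.direction_eq_top_iff_of_nonempty
    ((hne.mono (Set.subset_insert _ _)).mono (subset_affineSpan ℝ _))]
  refine Submodule.eq_top_of_finrank_eq (le_antisymm (Submodule.finrank_le _) ?_)
  rw [← hl]
  exact Submodule.finrank_lt_finrank_of_lt (AffineSubspace.direction_lt_of_nonempty hlt hne)

lemma center_mem_of_radius_eq_zero (h : s.IsTangent l)
    (hs : s.radius = 0) : s.center ∈ l := by
  obtain ⟨p, hp⟩ := h
  have := hp.mem_sphere
  rw [mem_sphere, hs, dist_eq_zero] at this
  exact this ▸ hp.mem_space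

variable [Nonempty l] [l.direction.HasOrthogonalProjection]

lemma abs_signedInfDist_center [FiniteDimensional ℝ V]
    (hl : Module.finrank ℝ l.direction + 1 = Module.finrank ℝ V) (hp : p ∉ l) (hs : s.IsTangent l) :
    |l.signedInfDist p s.center| = s.radius := by
  rw [AffineSubspace.abs_signedInfDist_eq_dist_of_mem_affineSpan_insert,
    dist_orthogonalProjection_eq_infDist, hs.infDist_eq_radius]
  rw [affineSpan_insert_eq_top hl hp]
  trivial

lemma signedInfDist_self_pos (hp : p ∉ l) : 0 < l.signedInfDist p p := by
  rw [AffineSubspace.signedInfDist_apply_self, norm_pos_iff, vsub_ne_zero]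
  exact fun h => hp (orthogonalProjection_eq_self_iff.1 h.symm)

lemma signedInfDist_nonneg_of_wSameSide {q : P} (hp : p ∉ l) (h : l.WSameSide q p) :
    0 ≤ l.signedInfDist p q :=
  nonneg_of_mul_nonneg_left (mul_nonneg_of_wSameSide h fun _ =>
    l.signedInfDist_apply_of_mem _) (signedInfDist_self_pos hp)

lemma signedInfDist_nonpos_of_wOppSide {q : P} (hp : p ∉ l) (h : l.WOppSide q p) :
    l.signedInfDist p q ≤ 0 :=
  nonpos_of_mul_nonpos_left (mul_nonpos_of_wOppSide h fun _ =>
    l.signedInfDist_apply_of_mem _) (signedInfDist_self_pos hp)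

lemma signedInfDist_center_of_wSameSide [FiniteDimensional ℝ V]
    (hl : Module.finrank ℝ l.direction + 1 = Module.finrank ℝ V) (hp : p ∉ l) (hs : s.IsTangent l)
    (h : l.WSameSide s.center p) : l.signedInfDist p s.center = s.radius := by
  rw [← abs_signedInfDist_center hl hp hs, abs_of_nonneg (signedInfDist_nonneg_of_wSameSide hp h)]

lemma signedInfDist_center_of_wOppSide [FiniteDimensional ℝ V]
    (hl : Module.finrank ℝ l.direction + 1 = Module.finrank ℝ V) (hp : p ∉ l) (hs : s.IsTangent l)
    (h : l.WOppSide s.center p) : l.signedInfDist p s.center = -s.radius := by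
  rw [← abs_signedInfDist_center hl hp hs, abs_of_nonpos (signedInfDist_nonpos_of_wOppSide hp h),
    neg_neg]

lemma radius_mul_signedInfDist_center {E : P} (hE : s.IsTangentAt E l) (Q : P) :
    s.radius * l.signedInfDist s.center Q = ⟪s.center -ᵥ E, Q -ᵥ E⟫ := by
  rw [AffineSubspace.signedInfDist_eq_signedDist_of_mem hE.mem_space, signedDist_apply_apply,
    ← hE.eq_orthogonalProjection, ← real_inner_smul_left, ← mem_sphere'.1 hE.mem_sphere,
    dist_eq_norm_vsub V, NormedSpace.norm_smul_normalize]

end Hyperplane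

section Line

variable [Fact (Module.finrank ℝ V = 2)]

lemma finrank_direction_line {B C : P} (h : B ≠ C) :
    Module.finrank ℝ line[ℝ, B, C].direction + 1 = Module.finrank ℝ V := by
  rw [direction_affineSpan, vectorSpan_pair_rev, finrank_span_singleton (vsub_ne_zero.2 h.symm),
    Fact.out (p := Module.finrank ℝ V = 2)]

lemma signedInfDist_incenter (t : Affine.Triangle ℝ P) {i₁ i₂ i₃ : Fin 3} (h₁₂ : i₁ ≠ i₂)
    (h₁₃ : i₁ ≠ i₃) (h₂₃ : i₂ ≠ i₃) :
    line[ℝ, t.points i₂, t.points i₃].signedInfDist (t.points i₁) t.incenter = t.inradius := by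
  have : FiniteDimensional ℝ V := .of_fact_finrank_eq_two
  have htan : t.insphere.IsTangent line[ℝ, t.points i₂, t.points i₃] := by
    rw [t.affineSpan_pair_eq_orthRadius_insphere h₁₂ h₁₃ h₂₃]
    exact (Sphere.isTangentAt_orthRadius_iff_mem.2 (t.touchpoint_mem_insphere i₁)).isTangent
  have hside := t.sSameSide_affineSpan_pair_incenter_point h₁₂ h₁₃ h₂₃
  exact signedInfDist_center_of_wSameSide
    (finrank_direction_line (t.independent.injective.ne h₂₃)) hside.2.2 htan hside.1

end Line

section Cartesian

/-- The affine functions `x` and `y` form a Cartesian coordinate system. -/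
def IsCartesian (x y : P →ᴬ[ℝ] ℝ) : Prop :=
  ∀ X Y Z W : P, ⟪X -ᵥ Y, Z -ᵥ W⟫ = (x X - x Y) * (x Z - x W) + (y X - y Y) * (y Z - y W)

lemma isCartesian_signedDist [Fact (Module.finrank ℝ V = 2)] {v w : V} (hv : v ≠ 0) (hw : w ≠ 0)
    (hvw : ⟪v, w⟫ = 0) (p q : P) : IsCartesian (signedDist v p) (signedDist w q) := by
  have horth : Orthonormal ℝ ![NormedSpace.normalize v, NormedSpace.normalize w] := by
    simp [orthonormal_vecCons_iff, NormedSpace.normalize, real_inner_smul_left,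
      real_inner_smul_right, hvw, norm_smul, hv, hw]
  let e := (basisOfOrthonormalOfCardEqFinrank horth
    (by simp [Fact.out (p := Module.finrank ℝ V = 2)])).toOrthonormalBasis (by simpa using horth)
  intro X Y Z W
  rw [signedDist_triangle_left, signedDist_triangle_left, signedDist_triangle_left,
    signedDist_triangle_left]
  simp only [signedDist_apply_apply]
  rw [← e.sum_inner_mul_inner]
  simp [e, Fin.sum_univ_two, real_inner_comm]

namespace IsCartesian

variable {x y : P →ᴬ[ℝ] ℝ} (h : IsCartesian x y)

include h

lemma dist_sq (X Y : P) : dist X Y ^ 2 = (x X - x Y) ^ 2 + (y X - y Y) ^ 2 := by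
  rw [dist_eq_norm_vsub V, ← real_inner_self_eq_norm_sq, h]
  ring

lemma mem_sphere_sq {s : Sphere P} {X : P} (hX : X ∈ s) :
    (x X - x s.center) ^ 2 + (y X - y s.center) ^ 2 = s.radius ^ 2 := by
  rw [← h.dist_sq, mem_sphere.1 hX]

lemma ext {X Y : P} (hx : x X = x Y) (hy : y X = y Y) : X = Y := by
  rw [← dist_eq_zero, ← sq_eq_zero_iff, h.dist_sq, hx, hy]
  ring

lemma exists_signedDist_eq {v : V} (hv : v ≠ 0) :
    ∃ α β : ℝ, α ^ 2 + β ^ 2 = 1 ∧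
      ∀ Z W, signedDist v W Z = α * (x Z - x W) + β * (y Z - y W) := by
  obtain ⟨O⟩ : Nonempty P := inferInstance
  refine ⟨x (NormedSpace.normalize v +ᵥ O) - x O, y (NormedSpace.normalize v +ᵥ O) - y O, ?_, ?_⟩
  · rw [← h.dist_sq, dist_vadd_left, NormedSpace.norm_normalize hv, one_pow]
  · intro Z W
    rw [signedDist_apply_apply, ← h, vadd_vsub]

lemma exists_signedInfDist_eq {l : AffineSubspace ℝ P} [Nonempty l]
    [l.direction.HasOrthogonalProjection] {X : P} (hX : X ∉ l) :
    ∃ α β : ℝ, α ^ 2 + β ^ 2 = 1 ∧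
      ∀ Z, ∀ W ∈ l, l.signedInfDist X Z = α * (x Z - x W) + β * (y Z - y W) := by
  have hne : X -ᵥ orthogonalProjection l X ≠ 0 :=
    vsub_ne_zero.2 fun h0 => hX (orthogonalProjection_eq_self_iff.1 h0.symm)
  obtain ⟨α, β, hu, hαβ⟩ := h.exists_signedDist_eq hne
  refine ⟨α, β, hu, fun Z W hW => ?_⟩
  rw [l.signedInfDist_eq_signedDist_of_mem hW, hαβ]

end IsCartesian

end Cartesian

section Frame

variable {A B C D X : P} {x y : P →ᴬ[ℝ] ℝ}

lemma notMem_line_of_affineIndependent (h : AffineIndependent ℝ ![A, B, C]) :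
    A ∉ line[ℝ, B, C] := fun hA =>
  affineIndependent_iff_not_collinear_set.1 h (collinear_insert_of_mem_affineSpan_pair hA)

/-- The data of the three configurations in terms of the signed radius `σ` of the circle `ωa` with
center `Q`: positive, negative or zero in the vertical, the inner and the degenerate case. -/
structure SignedConfig (A B C Q A' : P) (Ω ω : Sphere P) (k : AffineSubspace ℝ P) [Nonempty k]
    [k.direction.HasOrthogonalProjection] (σ : ℝ) : Prop where
  dist_AB : line[ℝ, A, B].signedInfDist C Q = -σ
  dist_AC : line[ℝ, A, C].signedInfDist B Q = -σ
  dist_k : k.signedInfDist ω.center Q = σ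
  touch : IsOrientedTangentAt Ω Q σ A'
  above : σ < 0 → 0 ≤ line[ℝ, B, C].signedInfDist A Q

/-- Cartesian coordinates with origin `D` and first axis `BC`, oriented so that `A` lies above the
axis, in which the circle `ω` rests on the axis at `D`, a point of the segment `BC`. -/
structure SawayamaFrame (A B C D : P) (ω : Sphere P) (x y : P →ᴬ[ℝ] ℝ) : Prop where
  isCartesian : IsCartesian x y
  ordinate : y = line[ℝ, B, C].signedInfDist A
  left_nonpos : x B ≤ 0
  right_nonneg : 0 ≤ x C
  left_lt_right : x B < x C
  abscissa_origin : x D = 0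
  origin_mem : D ∈ line[ℝ, B, C]
  abscissa_center : x ω.center = 0
  ordinate_center : y ω.center = ω.radius
  radius_pos : 0 < ω.radius

lemma exists_sawayamaFrame [Fact (Module.finrank ℝ V = 2)] {ω : Sphere P}
    (hABC : AffineIndependent ℝ ![A, B, C]) (hω : 0 < ω.radius)
    (hD : ω.IsTangentAt D line[ℝ, B, C]) (hDBC : Wbtw ℝ B D C)
    (hside : line[ℝ, B, C].SSameSide ω.center A) : ∃ x y, SawayamaFrame A B C D ω x y := by
  have : FiniteDimensional ℝ V := .of_fact_finrank_eq_two
  have hA := notMem_line_of_affineIndependent hABC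
  have hBC : B ≠ C := hABC.injective.ne (by decide : (1 : Fin 3) ≠ 2)
  have hdir : C -ᵥ B ∈ line[ℝ, B, C].direction :=
    AffineSubspace.vsub_mem_direction (right_mem_affineSpan_pair ..) (left_mem_affineSpan_pair ..)
  have horth : ⟪C -ᵥ B, A -ᵥ orthogonalProjection line[ℝ, B, C] A⟫ = 0 :=
    vsub_orthogonalProjection_mem_direction_orthogonal _ A _ hdir
  have hcart : IsCartesian (signedDist (C -ᵥ B) D) (line[ℝ, B, C].signedInfDist A) := by
    rw [AffineSubspace.signedInfDist_def]
    exact isCartesian_signedDist (vsub_ne_zero.2 hBC.symm)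
      (vsub_ne_zero.2 fun h => hA (orthogonalProjection_eq_self_iff.1 h.symm)) horth _ _
  obtain ⟨t, ⟨ht₀, ht₁⟩, rfl⟩ := hDBC
  refine ⟨_, _, hcart, rfl, ?_, ?_, ?_, ?_, hD.mem_space, ?_, ?_, hω⟩
  · rw [← signedDist_anticomm, signedDist_left_lineMap, signedDist_vsub_self]
    exact neg_nonpos.2 (by positivity)
  · rw [signedDist_lineMap_right, signedDist_vsub_self]
    exact mul_nonneg (sub_nonneg.2 ht₁) dist_nonneg
  · rw [← sub_pos, signedDist_triangle_left, signedDist_vsub_self]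
    exact dist_pos.2 hBC
  · exact signedDist_self _ _
  · refine signedDist_eq_zero_of_orthogonal ?_
    rw [hD.eq_orthogonalProjection]
    exact vsub_orthogonalProjection_mem_direction_orthogonal _ ω.center _ hdir
  · exact signedInfDist_center_of_wSameSide (finrank_direction_line hBC) hA hD.isTangent hside.1

namespace SawayamaFrame

variable {ω Ω : Sphere P} (h : SawayamaFrame A B C D ω x y)

include h

lemma ordinate_eq_zero (hX : X ∈ line[ℝ, B, C]) : y X = 0 := by
  rw [h.ordinate]
  exact AffineSubspace.signedInfDist_apply_of_mem _ hX

lemma ordinate_left : y B = 0 := h.ordinate_eq_zero (left_mem_affineSpan_pair ..)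

lemma ordinate_right : y C = 0 := h.ordinate_eq_zero (right_mem_affineSpan_pair ..)

lemma exists_bisectorParam [Fact (Module.finrank ℝ V = 2)] {Q : P} {σ : ℝ}
    (hABC : AffineIndependent ℝ ![A, B, C])
    (hQ : line[ℝ, A, B].signedInfDist C Q = -σ) (hQ' : line[ℝ, A, C].signedInfDist B Q = -σ) :
    ∃ m, BisectorParam (x B) (x C) (x (⟨![A, B, C], hABC⟩ : Affine.Triangle ℝ P).incenter)
      (y (⟨![A, B, C], hABC⟩ : Affine.Triangle ℝ P).incenter) (x Q) (y Q) σ m := by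
  set t : Affine.Triangle ℝ P := ⟨![A, B, C], hABC⟩
  have hA := notMem_line_of_affineIndependent hABC
  have hB := notMem_line_of_affineIndependent hABC.comm_left
  have hC := notMem_line_of_affineIndependent hABC.comm_right.comm_left
  have hr : y t.incenter = t.inradius := by
    rw [h.ordinate]
    exact signedInfDist_incenter t (i₁ := 0) (i₂ := 1) (i₃ := 2) (by decide) (by decide) (by decide)
  have hI : line[ℝ, A, B].signedInfDist C t.incenter = t.inradius :=
    signedInfDist_incenter t (i₁ := 2) (i₂ := 0) (i₃ := 1) (by decide) (by decide) (by decide)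
  have hI' : line[ℝ, A, C].signedInfDist B t.incenter = t.inradius :=
    signedInfDist_incenter t (i₁ := 1) (i₂ := 0) (i₃ := 2) (by decide) (by decide) (by decide)
  have hyA : 0 < y A := h.ordinate ▸ signedInfDist_self_pos hA
  have hC' := signedInfDist_self_pos hC
  have hB' := signedInfDist_self_pos hB
  have hA₀ := line[ℝ, A, B].signedInfDist_apply_of_mem (p := C) (left_mem_affineSpan_pair ..)
  have hA₀' := line[ℝ, A, C].signedInfDist_apply_of_mem (p := B) (left_mem_affineSpan_pair ..)
  obtain ⟨α, β, hu, hαβ⟩ := h.isCartesian.exists_signedInfDist_eq hC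
  obtain ⟨α', β', hu', hαβ'⟩ := h.isCartesian.exists_signedInfDist_eq hB
  replace hαβ Z := hαβ Z B (right_mem_affineSpan_pair ..)
  replace hαβ' Z := hαβ' Z C (right_mem_affineSpan_pair ..)
  simp only [hαβ, hαβ', h.ordinate_left, h.ordinate_right, sub_zero, mul_zero, add_zero, ← hr]
    at hQ hQ' hI hI' hB' hC' hA₀ hA₀'
  exact exists_bisectorParam_of_unit_normals h.left_lt_right (hr ▸ t.inradius_pos) hC' hB' hu hu'
    hI hI' hA₀ hA₀' hyA hQ hQ'

lemma touches_inside {Q : P} {τ : ℝ} (hR : 0 < Ω.radius) (hB : B ∈ Ω) (hC : C ∈ Ω)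
    (hτ : τ = ω.radius ∨ τ = -ω.radius) (hP : IsOrientedTangentAt Ω ω.center τ Q) :
    τ = ω.radius ∧ 2 * x Ω.center = x B + x C ∧
      2 * ω.radius * (Ω.radius - y Ω.center) = -(x B * x C) ∧ x B * x C < 0 := by
  have hB' := h.isCartesian.mem_sphere_sq hB
  have hC' := h.isCartesian.mem_sphere_sq hC
  have hdist := hP.dist_center_sq hR
  rw [h.ordinate_left, zero_sub, neg_sq] at hB'
  rw [h.ordinate_right, zero_sub, neg_sq] at hC'
  rw [h.isCartesian.dist_sq, h.abscissa_center, h.ordinate_center, zero_sub, neg_sq] at hdist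
  exact touches_inside_of_mem_segment h.left_nonpos h.right_nonneg h.left_lt_right h.radius_pos hR
    hB' hC' hτ hdist

lemma mem_circle_sq (hX : X ∈ ω) : x X ^ 2 + y X ^ 2 = 2 * ω.radius * y X := by
  have := h.isCartesian.mem_sphere_sq hX
  rw [h.abscissa_center, h.ordinate_center] at this
  linear_combination this

lemma contact_point_mem_polar {k : AffineSubspace ℝ P} [Nonempty k]
    [k.direction.HasOrthogonalProjection] {E Q : P} (hE : ω.IsTangentAt E k) :
    x E * x Q + y E * (y Q - ω.radius) =
      ω.radius * (y Q - k.signedInfDist ω.center Q) := by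
  have := radius_mul_signedInfDist_center hE Q
  rw [h.isCartesian, h.abscissa_center, h.ordinate_center] at this
  linear_combination this + h.mem_circle_sq hE.mem_sphere

lemma chord_side_nonneg {σ : ℝ} {A' E P' Q : P} (hR : 0 < Ω.radius)
    (hA' : IsOrientedTangentAt Ω Q σ A') (hP' : IsOrientedTangentAt Ω ω.center ω.radius P')
    (hsel : A' = P' ∨ line[ℝ, A', P'].WSameSide E D) {d₁ d₂ : ℝ}
    (hd₁ : d₁ = ω.radius * (x Q - x P') + σ * x P')
    (hd₂ : d₂ = ω.radius * (y Q - y P') + σ * (y P' - ω.radius)) :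
    0 ≤ (d₁ * (y E - y P') - d₂ * (x E - x P')) * (d₁ * (0 - y P') - d₂ * (0 - x P')) := by
  have hx := hA'.monge hP' x
  have hy := hA'.monge hP' y
  rw [h.abscissa_center, sub_zero, ← hd₁] at hx
  rw [h.ordinate_center, ← hd₂] at hy
  rcases hsel with rfl | hsel
  · rw [sub_self, mul_zero, zero_eq_mul, or_iff_right hR.ne'] at hx hy
    simp [hx, hy]
  · let f : P →ᴬ[ℝ] ℝ := d₁ • (y - .const ℝ P (y P')) - d₂ • (x - .const ℝ P (x P'))
    have hf (Z : P) : f Z = d₁ * (y Z - y P') - d₂ * (x Z - x P') := rfl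
    have hfA' : f A' = 0 := by
      apply mul_left_cancel₀ hR.ne'
      linear_combination Ω.radius * hf A' - (y A' - y P') * hx + (x A' - x P') * hy
    have hfP' : f P' = 0 := by simp [hf]
    have := mul_nonneg_of_wSameSide hsel fun Z hZ => by
      obtain ⟨t, rfl⟩ := mem_affineSpan_pair_iff_exists_lineMap_eq.1 hZ
      rw [f.apply_lineMap, hfA', hfP', AffineMap.lineMap_same_apply]
    rwa [hf, hf, h.abscissa_origin, h.ordinate_eq_zero h.origin_mem] at this

lemma radius_pos_of_mem (hB : B ∈ Ω) (hC : C ∈ Ω) : 0 < Ω.radius := by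
  refine (Sphere.radius_nonneg_of_mem hB).lt_of_ne' fun h0 => h.left_lt_right.ne ?_
  rw [mem_sphere, h0, dist_eq_zero] at hB hC
  rw [hB, hC]

lemma radius_eq {Q P' A' : P} {p r σ m : ℝ}
    (hm : BisectorParam (x B) (x C) p r (x Q) (y Q) σ m) (hσ : σ < y Q)
    (hB : B ∈ Ω) (hC : C ∈ Ω) (hP' : IsOrientedTangentAt Ω ω.center ω.radius P')
    (hA' : IsOrientedTangentAt Ω Q σ A') : ω.radius = -m * (x B * x C) := by
  have hR := h.radius_pos_of_mem hB hC
  obtain ⟨-, ho, hin, hbc⟩ := h.touches_inside hR hB hC (.inl rfl) hP'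
  have hB' := h.isCartesian.mem_sphere_sq hB
  have hQ := hA'.dist_center_sq hR
  rw [h.ordinate_left, zero_sub, neg_sq] at hB'
  rw [h.isCartesian.dist_sq] at hQ
  exact hm.radius_eq_of_touches hσ h.radius_pos hbc ho hin hB' hQ

lemma contact_point_mul_eq {k : AffineSubspace ℝ P} [Nonempty k]
    [k.direction.HasOrthogonalProjection]
    {Q P' A' E : P} {p r σ m : ℝ} (hm : BisectorParam (x B) (x C) p r (x Q) (y Q) σ m)
    (hQ : SignedConfig A B C Q A' Ω ω k σ) (hB : B ∈ Ω) (hC : C ∈ Ω)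
    (hP : P' ∈ ω) (hP' : IsOrientedTangentAt Ω ω.center ω.radius P') (hE : ω.IsTangentAt E k)
    (hsel : A' = P' ∨ line[ℝ, A', P'].WSameSide E D) : 0 < y E ∧ r * x E = p * y E := by
  have hR := h.radius_pos_of_mem hB hC
  have hσ : σ < y Q := hm.radius_lt_ordinate (h.ordinate ▸ hQ.above)
  have hρ := h.radius_eq hm hσ hB hC hP' hQ.touch
  obtain ⟨-, ho, hin, hbc⟩ := h.touches_inside hR hB hC (.inl rfl) hP'
  have hm₀ : 0 < m := by nlinarith [h.radius_pos]
  have hE' := h.mem_circle_sq hE.mem_sphere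
  have hk := h.contact_point_mem_polar hE (Q := Q)
  rw [hQ.dist_k] at hk
  have hPx := hP'.map x
  have hPy := hP'.map y
  rw [h.abscissa_center] at hPx
  rw [h.ordinate_center] at hPy
  obtain ⟨hyP, hxP⟩ := contact_point_coords h.radius_pos hρ ho hin hbc
    (h.mem_circle_sq hP) hPx hPy
  have hside := h.chord_side_nonneg hR hQ.touch hP' hsel rfl rfl
  have hyE := contact_point_ordinate_pos h.radius_pos hσ hE' hk
  refine ⟨hyE, ?_⟩
  rcases mul_eq_zero.1 (hm.contact_point_factorization hρ hE' hk) with hI | hother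
  · exact sub_eq_zero.1 hI
  · exact hm.eq_of_chord_side_nonneg hσ h.radius_pos hm₀ hρ hE' (h.mem_circle_sq hP)
      hxP hyE hyP rfl rfl hside (sub_eq_zero.1 hother)

lemma mem_line_of_mul_eq {E X : P} (hE : y E ≠ 0) (hX : y X * x E = x X * y E) :
    X ∈ line[ℝ, D, E] := by
  have : X = AffineMap.lineMap D E (y X / y E) := by
    apply h.isCartesian.ext
    · rw [ContinuousAffineMap.apply_lineMap, h.abscissa_origin, AffineMap.lineMap_apply_ring']
      field_simp
      linear_combination -hX
    · rw [ContinuousAffineMap.apply_lineMap, h.ordinate_eq_zero h.origin_mem,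
        AffineMap.lineMap_apply_ring']
      field_simp
      ring
  rw [this]
  exact AffineMap.lineMap_mem_affineSpan_pair _ _ _

end SawayamaFrame

end Frame

end Metric

section Plane

variable {A B C A' : Plane} {ωa Ω ω : Sphere Plane} {k : AffineSubspace ℝ Plane}

lemma CirclesTouchAt.mem_left {s t : Sphere Plane} {p : Plane} (h : CirclesTouchAt s t p) :
    p ∈ s := by
  rcases h with h | h | h
  exacts [h.mem_left, h.mem_left, h.mem_right]

lemma CirclesTouchAt.exists_isOrientedTangentAt {s t : Sphere Plane} {p : Plane}
    (h : CirclesTouchAt s t p) :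
    ∃ τ, (τ = s.radius ∨ τ = -s.radius) ∧ IsOrientedTangentAt t s.center τ p := by
  rcases h with h | h | h
  · exact ⟨_, .inr rfl, .of_isExtTangentAt h⟩
  · exact ⟨_, .inl rfl, .of_isIntTangentAt_left h⟩
  · exact ⟨_, .inl rfl, .of_isIntTangentAt_right h⟩

instance fact_finrank_plane : Fact (Module.finrank ℝ Plane = 2) := ⟨by simp⟩

variable [Nonempty k]

lemma VerticalConfig.signedConfig (h : VerticalConfig A B C ωa Ω ω k A')
    (hne : A ≠ B) (hne' : A ≠ C) (hAB : ωa.IsTangent line[ℝ, A, B])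
    (hAC : ωa.IsTangent line[ℝ, A, C])
    (hk : Module.finrank ℝ k.direction + 1 = Module.finrank ℝ Plane) (hka : ωa.IsTangent k) :
    SignedConfig A B C ωa.center A' Ω ω k ωa.radius where
  dist_AB := signedInfDist_center_of_wOppSide (finrank_direction_line hne) h.opp_AB.2.2 hAB
    h.opp_AB.1
  dist_AC := signedInfDist_center_of_wOppSide (finrank_direction_line hne') h.opp_AC.2.2 hAC
    h.opp_AC.1
  dist_k := signedInfDist_center_of_wSameSide hk h.side_k.2.1 hka h.side_k.1.symm
  touch := .of_isIntTangentAt_left h.touch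
  above hσ := (lt_asymm h.radius_pos hσ).elim

lemma InnerConfig.signedConfig (h : InnerConfig A B C ωa Ω ω k A')
    (hne : A ≠ B) (hne' : A ≠ C) (hAB : ωa.IsTangent line[ℝ, A, B])
    (hAC : ωa.IsTangent line[ℝ, A, C])
    (hk : Module.finrank ℝ k.direction + 1 = Module.finrank ℝ Plane) (hka : ωa.IsTangent k) :
    SignedConfig A B C ωa.center A' Ω ω k (-ωa.radius) where
  dist_AB := by
    rw [neg_neg]
    exact signedInfDist_center_of_wSameSide (finrank_direction_line hne) h.same_AB.2.2 hAB
      h.same_AB.1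
  dist_AC := by
    rw [neg_neg]
    exact signedInfDist_center_of_wSameSide (finrank_direction_line hne') h.same_AC.2.2 hAC
      h.same_AC.1
  dist_k := signedInfDist_center_of_wOppSide hk h.side_k.2.1 hka h.side_k.1.symm
  touch := .of_isExtTangentAt h.touch
  above _ := signedInfDist_nonneg_of_wSameSide h.same_BC.2.2 h.same_BC.1

lemma PointConfig.signedConfig (h : PointConfig ωa Ω A')
    (hAB : ωa.IsTangent line[ℝ, A, B]) (hAC : ωa.IsTangent line[ℝ, A, C])
    (hka : ωa.IsTangent k) : SignedConfig A B C ωa.center A' Ω ω k 0 where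
  dist_AB := by
    rw [neg_zero]
    exact AffineSubspace.signedInfDist_apply_of_mem _
      (center_mem_of_radius_eq_zero hAB h.radius_zero)
  dist_AC := by
    rw [neg_zero]
    exact AffineSubspace.signedInfDist_apply_of_mem _
      (center_mem_of_radius_eq_zero hAC h.radius_zero)
  dist_k := AffineSubspace.signedInfDist_apply_of_mem _
    (center_mem_of_radius_eq_zero hka h.radius_zero)
  touch := .of_radius_eq_zero h.radius_zero h.mem_left h.mem_right
  above hσ := (lt_irrefl _ hσ).elim

lemma exists_signedConfig (hABC : AffineIndependent ℝ ![A, B, C])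
    (hAB : ωa.IsTangent line[ℝ, A, B]) (hAC : ωa.IsTangent line[ℝ, A, C])
    (hk : Module.finrank ℝ k.direction = 1) (hka : ωa.IsTangent k)
    (h : VerticalConfig A B C ωa Ω ω k A' ∨ InnerConfig A B C ωa Ω ω k A' ∨ PointConfig ωa Ω A') :
    ∃ σ, SignedConfig A B C ωa.center A' Ω ω k σ := by
  have hk' : Module.finrank ℝ k.direction + 1 = Module.finrank ℝ Plane := by simp [hk]
  have hne : A ≠ B := hABC.injective.ne (by decide : (0 : Fin 3) ≠ 1)
  have hne' : A ≠ C := hABC.injective.ne (by decide : (0 : Fin 3) ≠ 2)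
  rcases h with h | h | h
  exacts [⟨_, h.signedConfig hne hne' hAB hAC hk' hka⟩,
    ⟨_, h.signedConfig hne hne' hAB hAC hk' hka⟩, ⟨_, h.signedConfig hAB hAC hka⟩]

end Plane

/-- Generalized Sawayama Lemma. -/
theorem theorem2p3
    (A B C : Plane) (hABC : AffineIndependent ℝ ![A, B, C])
    (ωa Ω ω : Sphere Plane) (k : AffineSubspace ℝ Plane) (A' P D E : Plane)
    -- `ωa` touches the lines `AB` and `AC`; `Ω` passes through `B` and `C`
    (hAB : ωa.IsTangent line[ℝ, A, B]) (hAC : ωa.IsTangent line[ℝ, A, C])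
    (hB : B ∈ Ω) (hC : C ∈ Ω)
    -- `k` is a line touching `ωa`
    (hk : Module.finrank ℝ k.direction = 1) (hka : ωa.IsTangent k)
    -- `ω` touches the segment `BC` at `D`, the circle `Ω` at `P` and the line `k` at `E`,
    -- and lies on the same side of `BC` as `A`
    (hω : 0 < ω.radius)
    (hD : ω.IsTangentAt D line[ℝ, B, C]) (hDBC : D ∈ segment ℝ B C)
    (hP : CirclesTouchAt ω Ω P)
    (hE : ω.IsTangentAt E k)
    (hside : line[ℝ, B, C].SSameSide ω.center A)
    -- the configuration; `A'` is the point where `ωa` touches `Ω`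
    (hconf : VerticalConfig A B C ωa Ω ω k A' ∨ InnerConfig A B C ωa Ω ω k A' ∨
      PointConfig ωa Ω A')
    -- of the two admissible common tangents of `ωa` and `ω`, the line `k` is the one touching `ω`
    -- on the same side of `A'P` as `BC` does (nothing to choose if `A' = P`)
    (hsel : A' = P ∨ line[ℝ, A', P].SSameSide E D) :
    D ≠ E ∧ (⟨![A, B, C], hABC⟩ : Affine.Triangle ℝ Plane).incenter ∈ line[ℝ, D, E] := by
  have : Nonempty k := ⟨E, hE.mem_space⟩
  obtain ⟨σ, hσ⟩ := exists_signedConfig hABC hAB hAC hk hka hconf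
  obtain ⟨x, y, h⟩ := exists_sawayamaFrame hABC hω hD (mem_segment_iff_wbtw.1 hDBC) hside
  obtain ⟨τ, hτ, hPΩ⟩ := hP.exists_isOrientedTangentAt
  obtain ⟨rfl, -⟩ := h.touches_inside (h.radius_pos_of_mem hB hC) hB hC hτ hPΩ
  obtain ⟨m, hm⟩ := h.exists_bisectorParam hABC hσ.dist_AB hσ.dist_AC
  obtain ⟨hyE, hI⟩ := h.contact_point_mul_eq hm hσ hB hC hP.mem_left hPΩ hE
    (hsel.imp_right And.left)
  refine ⟨?_, h.mem_line_of_mul_eq hyE.ne' hI⟩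
  rintro rfl
  exact hyE.ne' (h.ordinate_eq_zero hD.mem_space)
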